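/- A modular ortholattice (MOL) is a modular lattice $L$ with bounds $0,1$ and a unary operation $a\mapsto a'$ such that $a+a'=1$, $aa'=0$, $a''=a$, and $a\le b$ implies $b'\le a'$ (joins are written $a+b$, meets $ab$). It is finite-dimensional if it has a finite maximal chain, and atomic if every $a>0$ lies above an atom. A projective space is a set $P$ of points with a set of $3$-element subsets, the collinear triplets, such that: if $p,q,r$ are distinct points not forming a collinear triplet, and $\{p,s,q\}$ and $\{q,t,r\}$ are collinear triplets, then there is a unique point $u$ such that $\{p,r,u\}$ and $\{s,t,u\}$ are collinear triplets. A subspace is a set $U\subseteq P$ that contains $r$ whenever $\{p,q,r\}$ is a collinear triplet with $p,q\in U$; the subspaces, ordered by inclusion, form a lattice $\mathcal S(P)$, and points are identified with singleton subspaces. An orthogonality on $P$ is a symmetric relation $\perp$ on $P$ such that $p\perp q$, $p\perp r$ and $s\le q+r$ imply $p\perp s$; for subspaces, $U\perp V$ means that $p\perp q$ for all $p\in U$, $q\in V$, and $U^\perp$ is the subspace of all points orthogonal to all points of $U$. It is anisotropic if $p\not\perp p$ for every point $p$. It is a polarity if for every point $p$ there is a point $q$ with $p\not\perp q$, and $p^\perp$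 is a coatom of $\mathcal S(P)$ for every point $p$. Theorem. For every modular ortholattice $L$ the following are equivalent: 1. $L$ is proatomic, i.e. $L$ belongs to the variety (equational class) generated by the finite-dimensional MOLs: $L$ satisfies every identity in the operations $+,\cdot,{}',0,1$ that holds in all finite-dimensional MOLs. 2. $L$ has an atomic MOL-extension, i.e. $L$ is isomorphic to a subalgebra (with respect to $+,\cdot,{}',0,1$) of an atomic MOL. 3. $L$ has a geometric representation, i.e. there are a projective space $P$ with an anisotropic polarity $\perp$ and an injective lattice homomorphism $\eta:L\to\mathcal S(P)$ preserving $0$ and $1$ such that $\eta(a)\perp\eta(a')$ for all $a\in L$ (by modularity of $\mathcal S(P)$, this means $\eta(a')=\eta(a)^\perp$ for all $a\in L$). -/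

import Mathlib

universe u

namespace MOL

/-- An ortholattice: a bounded lattice with an orthocomplementation, written `aᶜ`. -/
class Ortholattice (L : Type u) extends Lattice L, BoundedOrder L, Compl L where
  sup_compl_self : ∀ x : L, x ⊔ xᶜ = ⊤
  inf_compl_self : ∀ x : L, x ⊓ xᶜ = ⊥
  compl_compl_self : ∀ x : L, xᶜᶜ = x
  compl_antitone : ∀ x y : L, x ≤ y → yᶜ ≤ xᶜ

/-- A modular ortholattice (MOL). -/
class ModularOrtholattice (L : Type u) extends Ortholattice L, IsModularLattice L

/-- The height (the minimal length of a maximal chain) of the lattice is finite: there is a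
finite maximal chain. -/
def IsFiniteDimensional (L : Type u) [Lattice L] : Prop :=
  ∃ c : Set L, c.Finite ∧ IsMaxChain (· ≤ ·) c

/-! ### Varieties -/

/-- Terms in the signature `(+, ·, ', 0, 1)` of ortholattices, with variables indexed by `ℕ`. -/
inductive OrthoTerm : Type
  | var : ℕ → OrthoTerm
  | zero : OrthoTerm
  | one : OrthoTerm
  | join : OrthoTerm → OrthoTerm → OrthoTerm
  | meet : OrthoTerm → OrthoTerm → OrthoTerm
  | compl : OrthoTerm → OrthoTerm

/-- The value of a term under an assignment of its variables. -/
def OrthoTerm.eval {L : Type u} [Ortholattice L] (v : ℕ → L) : OrthoTerm → L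
  | .var n => v n
  | .zero => ⊥
  | .one => ⊤
  | .join s t => s.eval v ⊔ t.eval v
  | .meet s t => s.eval v ⊓ t.eval v
  | .compl s => (s.eval v)ᶜ

/-- The identity `s = t` holds in `L`. -/
def Satisfies (L : Type u) [Ortholattice L] (s t : OrthoTerm) : Prop :=
  ∀ v : ℕ → L, s.eval v = t.eval v

/-- `L` lies in the variety (equational class) generated by the finite-dimensional MOLs: it
satisfies every identity that holds in all finite-dimensional MOLs. -/
def IsProatomic (L : Type u) [ModularOrtholattice L] : Prop :=
  ∀ s t : OrthoTerm,
    (∀ (M : Type u) [ModularOrtholattice M], IsFiniteDimensional M → Satisfies M s t) →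
      Satisfies L s t

/-! ### Atomic extensions -/

/-- `L` is, up to isomorphism, a subalgebra of an atomic MOL: it embeds into one by an injective
map preserving joins, meets, `0`, `1` and the orthocomplementation. -/
def HasAtomicExtension (L : Type u) [ModularOrtholattice L] : Prop :=
  ∃ (M : Type u) (_ : ModularOrtholattice M) (f : BoundedLatticeHom L M),
    IsAtomic M ∧ Function.Injective f ∧ ∀ a : L, f aᶜ = (f a)ᶜ

/-! ### Projective spaces and their subspaces -/

/-- A projective space: a set of points with a set of collinear triplets, which are 3-element
subsets (given here as a totally symmetric relation between distinct points), satisfying the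
triangle axiom. The space may be reducible. -/
class ProjectiveSpace (P : Type u) where
  Collinear : P → P → P → Prop
  ne_of_collinear : ∀ {p q r : P}, Collinear p q r → p ≠ q
  collinear_swap : ∀ {p q r : P}, Collinear p q r → Collinear q p r
  collinear_rotate : ∀ {p q r : P}, Collinear p q r → Collinear q r p
  triangle : ∀ {p q r s t : P}, Collinear p s q → Collinear q t r → p ≠ r →
    ¬ Collinear p q r → ∃! u : P, Collinear p r u ∧ Collinear s t u

/-- A subspace of a projective space. -/
@[ext]
structure ProjSubspace (P : Type u) [ProjectiveSpace P] where
  carrier : Set P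
  closed : ∀ {p q r : P}, p ∈ carrier → q ∈ carrier →
    ProjectiveSpace.Collinear p q r → r ∈ carrier

namespace ProjSubspace

variable {P : Type u} [ProjectiveSpace P]

instance : SetLike (ProjSubspace P) P where
  coe := carrier
  coe_injective _ _ h := ProjSubspace.ext h

/-- Subspaces are ordered by inclusion. -/
instance : PartialOrder (ProjSubspace P) := PartialOrder.ofSetLike (ProjSubspace P) P

instance : InfSet (ProjSubspace P) where
  sInf S :=
    { carrier := {p | ∀ U ∈ S, p ∈ U}
      closed := fun hp hq h U hU => U.closed (hp U hU) (hq U hU) h }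

theorem isGLB_sInf (S : Set (ProjSubspace P)) : IsGLB S (sInf S) :=
  ⟨fun U hU _ hp => hp U hU, fun _ hV _ hp _ hU => hV hU hp⟩

/-- The lattice of all subspaces: the order is inclusion and meets are intersections (so the
join of two subspaces is the least subspace that contains both). -/
instance : CompleteLattice (ProjSubspace P) where
  __ := completeLatticeOfInf (ProjSubspace P) isGLB_sInf
  inf U V :=
    { carrier := {p | p ∈ U ∧ p ∈ V}
      closed := fun hp hq h => ⟨U.closed hp.1 hq.1 h, V.closed hp.2 hq.2 h⟩ }
  inf_le_left _ _ _ hp := hp.1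
  inf_le_right _ _ _ hp := hp.2
  le_inf _ _ _ h₁ h₂ _ hp := ⟨h₁ hp, h₂ hp⟩
  top := ⟨Set.univ, fun _ _ _ => trivial⟩
  le_top _ _ _ := trivial
  bot := ⟨∅, fun hp _ _ => hp.elim⟩
  bot_le _ _ hp := hp.elim

/-- A point, regarded as a singleton subspace. -/
def point (p : P) : ProjSubspace P where
  carrier := {p}
  closed hq hr h := absurd (hq.trans hr.symm) (ProjectiveSpace.ne_of_collinear h)

theorem mem_point_sup_point {p q r : P} (h : ProjectiveSpace.Collinear p q r) :
    point r ≤ point p ⊔ point q := by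
  rintro x rfl
  exact (point p ⊔ point q).closed ((le_sup_left : point p ≤ point p ⊔ point q) rfl)
    ((le_sup_right : point q ≤ point p ⊔ point q) rfl) h

end ProjSubspace

/-! ### Orthogonalities and polarities -/

open ProjSubspace in
/-- An orthogonality on (the set of points of) a projective space. -/
structure Orthogonality (P : Type u) [ProjectiveSpace P] where
  Perp : P → P → Prop
  symm : ∀ {p q : P}, Perp p q → Perp q p
  perp_of_le_sup : ∀ {p q r s : P}, Perp p q → Perp p r →
    point s ≤ point q ⊔ point r → Perp p s

namespace Orthogonality

variable {P : Type u} [ProjectiveSpace P] (o : Orthogonality P)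

/-- The orthogonality of subspaces: all points of `U` are orthogonal to all points of `V`. -/
def SubspacePerp (U V : ProjSubspace P) : Prop :=
  ∀ p ∈ U, ∀ q ∈ V, o.Perp p q

/-- The subspace `U^⊥` of all points orthogonal to `U`. -/
def orth (U : ProjSubspace P) : ProjSubspace P where
  carrier := {q | ∀ p ∈ U, o.Perp p q}
  closed hq hr h p hp :=
    o.perp_of_le_sup (hq p hp) (hr p hp) (ProjSubspace.mem_point_sup_point h)

/-- No point is orthogonal to itself. -/
def IsAnisotropic : Prop :=
  ∀ p : P, ¬ o.Perp p p

/-- A polarity: a nondegenerate orthogonality such that `p^⊥` is a coatom of the subspace lattice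
for each point `p`. -/
def IsPolarity : Prop :=
  (∀ p : P, ∃ q : P, ¬ o.Perp p q) ∧ ∀ p : P, IsCoatom (o.orth (ProjSubspace.point p))

end Orthogonality

/-- `L` has a geometric representation: an embedding of bounded lattices into the subspace
lattice of a projective space with an anisotropic polarity, such that the image of `a` is
orthogonal to the image of `aᶜ` for all `a`. -/
def HasGeometricRepresentation (L : Type u) [ModularOrtholattice L] : Prop :=
  ∃ (P : Type u) (_ : ProjectiveSpace P) (o : Orthogonality P)
    (η : BoundedLatticeHom L (ProjSubspace P)),
    o.IsPolarity ∧ o.IsAnisotropic ∧ Function.Injective η ∧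
      ∀ a : L, o.SubspacePerp (η a) (η aᶜ)

end MOL

/-! Atomic extensions give proatomicity because, in an atomic MOL, an atom below the value of a term
is still below the value computed in the interval under a sufficiently large finite join of atoms,
and such an interval is finite-dimensional.

Conversely, by Birkhoff's theorem a proatomic `L` is a quotient of a subalgebra of an atomic MOL
`N`. Only atoms orthogonal to the kernel of the quotient map can represent `L`, and `N` may have too
few of them. An ultrapower of `N` has enough: use the atoms that lie below `c k(i)ᶜ` in each
coordinate `i`, where `c 0 ≤ c 1 ≤ …` is a fast growing chain in the kernel that depends on `i`, and
`k(i)` tends to infinity along the ultrafilter. Decomposing such an atom along a join costs one step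
of the chain, and any finite number of steps is available.

Finally, for an anisotropic polarity, the subspaces obtained from the image of `L` by finitely many
joins with points `p` and meets with hyperplanes `p^⊥` form an atomic MOL. -/

namespace MOL

/-! ### Ortholattices and their terms -/

namespace Ortholattice

section Ortholattice

variable {L : Type*} [Ortholattice L] {a b : L}

theorem compl_le_compl (h : a ≤ b) : bᶜ ≤ aᶜ := compl_antitone _ _ h

theorem le_compl_comm : a ≤ bᶜ ↔ b ≤ aᶜ := by
  constructor <;> intro h <;> simpa only [compl_compl_self] using compl_le_compl h

theorem compl_sup (a b : L) : (a ⊔ b)ᶜ = aᶜ ⊓ bᶜ :=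
  le_antisymm (le_inf (compl_le_compl le_sup_left) (compl_le_compl le_sup_right))
    (le_compl_comm.1 (sup_le (le_compl_comm.1 inf_le_left) (le_compl_comm.1 inf_le_right)))

theorem compl_inf (a b : L) : (a ⊓ b)ᶜ = aᶜ ⊔ bᶜ := by
  rw [← compl_compl_self (aᶜ ⊔ bᶜ), compl_sup, compl_compl_self, compl_compl_self]

theorem compl_bot : (⊥ : L)ᶜ = ⊤ := by
  simpa only [bot_sup_eq] using sup_compl_self (⊥ : L)

theorem compl_top : (⊤ : L)ᶜ = ⊥ := by
  simpa only [top_inf_eq] using inf_compl_self (⊤ : L)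

theorem isCompl_compl (a : L) : IsCompl a aᶜ :=
  .of_eq (inf_compl_self a) (sup_compl_self a)

instance : ComplementedLattice L := ⟨fun a => ⟨aᶜ, isCompl_compl a⟩⟩

theorem eq_bot_of_le_of_le_compl {x : L} (h : x ≤ a) (h' : x ≤ aᶜ) : x = ⊥ :=
  le_bot_iff.1 ((isCompl_compl a).disjoint h h')

/-- The element `s(st)'`, which measures the failure of `s ≤ t`. -/
def excess (s t : L) : L := s ⊓ (s ⊓ t)ᶜ

theorem excess_eq_bot_of_le (h : a ≤ b) : excess a b = ⊥ := by
  rw [excess, inf_eq_left.2 h, inf_compl_self]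

end Ortholattice

section Modular

variable {L : Type*} [ModularOrtholattice L] {a b x : L}

theorem sup_inf_compl_of_le (h : b ≤ a) : b ⊔ a ⊓ bᶜ = a := by
  rw [inf_comm, ← sup_inf_assoc_of_le _ h, sup_compl_self, top_inf_eq]

theorem inf_compl_inf_compl_of_le (h : b ≤ a) : a ⊓ (a ⊓ bᶜ)ᶜ = b := by
  rw [compl_inf, compl_compl_self, sup_comm, inf_comm, sup_inf_assoc_of_le _ h, inf_comm,
    inf_compl_self, sup_bot_eq]

theorem le_of_le_of_le_compl_excess (ha : x ≤ a) (h : x ≤ (excess a b)ᶜ) : x ≤ b :=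
  ((le_inf ha h).trans (inf_compl_inf_compl_of_le inf_le_left).le).trans inf_le_right

theorem excess_eq_bot : excess a b = ⊥ ↔ a ≤ b :=
  ⟨fun h => le_of_le_of_le_compl_excess le_rfl (by rw [h, compl_bot]; exact le_top),
    excess_eq_bot_of_le⟩

end Modular

end Ortholattice

theorem OrthoTerm.eval_map {L M : Type*} [Ortholattice L] [Ortholattice M]
    (f : BoundedLatticeHom L M) (hf : ∀ a, f aᶜ = (f a)ᶜ) (v : ℕ → L) (t : OrthoTerm) :
    f (t.eval v) = t.eval (f ∘ v) := by
  induction t with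
  | var n => rfl
  | zero => exact map_bot f
  | one => exact map_top f
  | join s t hs ht => simp only [eval, map_sup, hs, ht]
  | meet s t hs ht => simp only [eval, map_inf, hs, ht]
  | compl s hs => simp only [eval, hf, hs]

/-- The term whose value is the excess of the value of `s` over the value of `t`; it turns an
inequality between terms into an identity of the form `r = 0`. -/
def OrthoTerm.excess (s t : OrthoTerm) : OrthoTerm := .meet s (.compl (.meet s t))

theorem OrthoTerm.eval_excess {L : Type*} [Ortholattice L] (v : ℕ → L) (s t : OrthoTerm) :
    (s.excess t).eval v = Ortholattice.excess (s.eval v) (t.eval v) := rfl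

theorem satisfies_iff_excess {L : Type*} [ModularOrtholattice L] {s t : OrthoTerm} :
    Satisfies L s t ↔ Satisfies L (s.excess t) .zero ∧ Satisfies L (t.excess s) .zero := by
  simp only [Satisfies, OrthoTerm.eval_excess, ← forall_and]
  exact forall_congr' fun v => le_antisymm_iff.trans
    (and_congr Ortholattice.excess_eq_bot Ortholattice.excess_eq_bot).symm

/-- The interval below `u`, with the relative orthocomplement `x ↦ u xᶜ`. -/
instance iicModularOrtholattice {L : Type*} [ModularOrtholattice L] (u : L) :
    ModularOrtholattice (Set.Iic u) where
  compl x := ⟨u ⊓ x.1ᶜ, inf_le_left⟩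
  sup_compl_self x := Subtype.ext (Ortholattice.sup_inf_compl_of_le x.2)
  inf_compl_self _ := Subtype.ext <|
    Ortholattice.eq_bot_of_le_of_le_compl inf_le_left (inf_le_right.trans inf_le_right)
  compl_compl_self x := Subtype.ext (Ortholattice.inf_compl_inf_compl_of_le x.2)
  compl_antitone _ _ h := inf_le_inf_left u (Ortholattice.compl_le_compl h)
  toIsModularLattice := inferInstance

instance piModularOrtholattice {ι : Type*} (M : ι → Type*) [∀ i, ModularOrtholattice (M i)] :
    ModularOrtholattice (∀ i, M i) where
  compl x i := (x i)ᶜ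
  sup_compl_self x := funext fun i => Ortholattice.sup_compl_self (x i)
  inf_compl_self x := funext fun i => Ortholattice.inf_compl_self (x i)
  compl_compl_self x := funext fun i => Ortholattice.compl_compl_self (x i)
  compl_antitone _ _ h i := Ortholattice.compl_le_compl (h i)
  sup_inf_le_assoc_of_le y _ h i := IsModularLattice.sup_inf_le_assoc_of_le (y i) (h i)

theorem OrthoTerm.eval_pi {ι : Type*} {M : ι → Type*} [∀ i, ModularOrtholattice (M i)]
    (v : ℕ → ∀ i, M i) (t : OrthoTerm) (i : ι) : t.eval v i = t.eval (fun n => v n i) :=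
  OrthoTerm.eval_map { Pi.evalLatticeHom i with map_top' := rfl, map_bot' := rfl }
    (fun _ => rfl) v t

/-! ### Atoms of modular lattices -/

theorem sup_inf_sup_of_le_sup {L : Type*} [Lattice L] [IsModularLattice L] {a s t : L}
    (ht : t ≤ s ⊔ a) : s ⊔ a ⊓ (s ⊔ t) = s ⊔ t := by
  rw [← sup_inf_assoc_of_le _ le_sup_left, inf_eq_right]
  exact sup_le le_sup_left ht

section Atoms

variable {L : Type*} [Lattice L] [OrderBot L] [IsModularLattice L] {a b p s t x : L}

theorem covBy_sup_of_isAtom (hx : IsAtom x) (h : ¬ x ≤ a) : a ⋖ a ⊔ x := by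
  apply covBy_sup_of_inf_covBy_right
  rwa [((hx.not_le_iff_disjoint).1 h).symm.eq_bot, bot_covBy_iff]

theorem le_sup_of_le_sup_of_not_le (hx : IsAtom x) (hp : p ≤ a ⊔ x) (hpa : ¬ p ≤ a) :
    x ≤ a ⊔ p := by
  have hxa : ¬ x ≤ a := fun h => hpa (hp.trans (sup_le le_rfl h))
  have hap : a ⊔ p = a ⊔ x := ((covBy_sup_of_isAtom hx hxa).eq_or_eq le_sup_left
    (sup_le le_sup_left hp)).resolve_left (left_lt_sup.2 hpa).ne'
  exact hap ▸ le_sup_right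

theorem isAtom_of_covBy_sup (h : b ⋖ b ⊔ x) (hd : Disjoint b x) : IsAtom x := by
  rw [← bot_covBy_iff, ← hd.eq_bot]
  exact inf_covBy_of_covBy_sup_left h

theorem isAtom_inf_sup (hs : IsAtom s) (ht : IsAtom t) (hts : t ≤ s ⊔ a) (hne : t ≠ s)
    (hsa : ¬ s ≤ a) : IsAtom (a ⊓ (s ⊔ t)) := by
  apply isAtom_of_covBy_sup (b := s)
  · rw [sup_inf_sup_of_le_sup hts]
    exact covBy_sup_of_isAtom ht fun h => hne ((hs.le_iff.1 h).resolve_left ht.1)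
  · exact (hs.not_le_iff_disjoint.1 hsa).mono_right inf_le_left

end Atoms

theorem exists_atoms_of_le_sup {L : Type*} [Lattice L] [BoundedOrder L] [IsModularLattice L]
    [ComplementedLattice L] {a b p : L} (hp : IsAtom p) (hab : p ≤ a ⊔ b) (ha : ¬ p ≤ a)
    (hb : ¬ p ≤ b) : ∃ q r, IsAtom q ∧ IsAtom r ∧ q ≤ a ∧ r ≤ b ∧ p ≤ q ⊔ r := by
  obtain ⟨z, hz⟩ := exists_isCompl (a ⊓ b)
  set x := z ⊓ (a ⊓ (b ⊔ p))
  have hxa : x ≤ a := inf_le_right.trans inf_le_left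
  have hbx_disj : Disjoint b x := fun _ hyb hyx =>
    hz.disjoint (le_inf (hyx.trans hxa) hyb) (hyx.trans inf_le_left)
  have hbx : b ⊔ x = b ⊔ p := calc
    b ⊔ x = b ⊔ (a ⊓ b ⊔ x) := by rw [← sup_assoc, sup_eq_left.2 (inf_le_right : a ⊓ b ≤ b)]
    _ = b ⊔ a ⊓ (b ⊔ p) := by
      rw [← sup_inf_assoc_of_le z (inf_le_inf_left a le_sup_left), hz.sup_eq_top, top_inf_eq]
    _ = b ⊔ p := sup_inf_sup_of_le_sup (by rwa [sup_comm])
  have hx_atom : IsAtom x := isAtom_of_covBy_sup (hbx ▸ covBy_sup_of_isAtom hp hb) hbx_disj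
  have hpx : p ≤ x ⊔ b := by rw [sup_comm, hbx]; exact le_sup_right
  refine ⟨x, b ⊓ (x ⊔ p), hx_atom, isAtom_inf_sup hx_atom hp hpx (fun h => ha (h ▸ hxa))
    (hx_atom.not_le_iff_disjoint.2 hbx_disj.symm), hxa, inf_le_left, ?_⟩
  rw [sup_inf_sup_of_le_sup hpx]
  exact le_sup_right

/-! ### Finite-dimensional lattices -/

theorem IsFiniteDimensional.isAtomic {L : Type*} [Lattice L] [BoundedOrder L]
    [IsModularLattice L] (h : IsFiniteDimensional L) : IsAtomic L := by
  obtain ⟨c, hfin, hc⟩ := h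
  let C := Flag.ofIsMaxChain c hc
  have : Finite C := hfin
  refine ⟨fun a => or_iff_not_imp_left.2 fun ha => ?_⟩
  obtain ⟨x, hx, hmin⟩ := WellFounded.has_min (wellFounded_lt (α := C))
    {x | ¬ Disjoint a x} ⟨⊤, fun h => ha (disjoint_top.1 h)⟩
  have hx_bot : x ≠ ⊥ := fun h => hx (h ▸ disjoint_bot_right)
  obtain ⟨y, -, hyx⟩ := exists_le_covBy_of_lt (bot_lt_iff_ne_bot.2 hx_bot)
  have hay : Disjoint a y.1 := not_not.1 fun h => hmin y h hyx.lt
  have hy : Disjoint y.1 (a ⊓ x) := hay.symm.mono_right inf_le_left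
  have hsup : y.1 ⊔ a ⊓ x = x := ((Flag.coe_covBy_coe.2 hyx).eq_or_eq le_sup_left
    (sup_le hyx.le inf_le_right)).resolve_left fun h => hx <| disjoint_iff.2 <|
      hy.eq_bot_of_ge (left_eq_sup.1 h.symm)
  exact ⟨a ⊓ x, isAtom_of_covBy_sup (hsup.symm ▸ Flag.coe_covBy_coe.2 hyx) hy, inf_le_left⟩

theorem isFiniteDimensional_Iic_of_covBy {L : Type*} [Lattice L] {a b : L} (hab : a ⋖ b)
    (h : IsFiniteDimensional (Set.Iic a)) : IsFiniteDimensional (Set.Iic b) := by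
  obtain ⟨c, hfin, hc⟩ := h
  let i := Set.inclusion (Set.Iic_subset_Iic.2 hab.le)
  have hi : Monotone i := fun _ _ h => h
  refine ⟨insert ⊤ (i '' c), (hfin.image i).insert _,
    (hi.isChain_image hc.1).insert fun _ _ _ => .inr le_top, fun d hd hcd => hcd.antisymm ?_⟩
  intro x hx
  have hcomp : ∀ y ∈ c, i y ≤ x ∨ x ≤ i y := fun y hy =>
    hd.total (hcd (.inr ⟨y, hy, rfl⟩)) hx
  rcases hcomp ⊤ hc.top_mem with hax | hxa
  · rcases hab.eq_or_eq hax x.2 with h | h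
    · exact .inr ⟨⊤, hc.top_mem, Subtype.ext h.symm⟩
    · exact .inl (Subtype.ext h)
  · have hxc : (⟨x, hxa⟩ : Set.Iic a) ∈ Flag.ofIsMaxChain c hc :=
      Flag.mem_iff_forall_le_or_ge.2 fun y hy => (hcomp y hy).symm
    exact .inr ⟨_, hxc, rfl⟩

theorem isFiniteDimensional_Iic_finset_sup {L ι : Type*} [Lattice L] [OrderBot L]
    [IsModularLattice L] {f : ι → L} (hf : ∀ i, IsAtom (f i)) (F : Finset ι) :
    IsFiniteDimensional (Set.Iic (F.sup f)) := by
  classical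
  induction F using Finset.induction_on with
  | empty =>
    rw [Finset.sup_empty]
    have : Subsingleton (Set.Iic (⊥ : L)) := ⟨fun x y => Subtype.ext <|
      (le_bot_iff.1 x.2).trans (le_bot_iff.1 y.2).symm⟩
    exact ⟨Set.univ, Set.toFinite _, Set.subsingleton_univ.isChain,
      fun _ _ h => h.antisymm (Set.subset_univ _)⟩
  | insert i F _ ih =>
    rw [Finset.sup_insert, sup_comm]
    by_cases hi : f i ≤ F.sup f
    · rwa [sup_eq_left.2 hi]
    · exact isFiniteDimensional_Iic_of_covBy (covBy_sup_of_isAtom (hf i) hi) ih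

/-! ### Atomic modular ortholattices are proatomic -/

section Truncation

open Filter

/-- A family `f` indexed by the finite sets of atoms dominates `a` if each atom below `a` eventually
lies below the members of `f`. -/
def EventuallyDominates {N : Type*} [Lattice N] [OrderBot N]
    (f : Finset {p : N // IsAtom p} → N) (a : N) : Prop :=
  ∀ p, IsAtom p → p ≤ a → ∀ᶠ F in atTop, p ≤ f F

theorem eventuallyDominates_sup_inf {N : Type*} [Lattice N] [OrderBot N] (a : N) :
    EventuallyDominates (fun F => F.sup Subtype.val ⊓ a) a := fun p hp hpa => by
  filter_upwards [eventually_ge_atTop {⟨p, hp⟩}] with F hF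
  exact le_inf (Finset.le_sup (f := Subtype.val) (Finset.singleton_subset_iff.1 hF)) hpa

namespace EventuallyDominates

variable {N : Type*} [Lattice N] [BoundedOrder N] {f g : Finset {p : N // IsAtom p} → N} {a b : N}

theorem mono (hf : EventuallyDominates f a) (h : ∀ F, f F ≤ g F) : EventuallyDominates g a :=
  fun p hp hpa => (hf p hp hpa).mono fun F hF => hF.trans (h F)

theorem inf (hf : EventuallyDominates f a) (hg : EventuallyDominates g b) :
    EventuallyDominates (fun F => f F ⊓ g F) (a ⊓ b) := fun p hp hpab => by
  filter_upwards [hf p hp (hpab.trans inf_le_left), hg p hp (hpab.trans inf_le_right)]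
    with F hfF hgF using le_inf hfF hgF

theorem sup [IsModularLattice N] [ComplementedLattice N] (hf : EventuallyDominates f a)
    (hg : EventuallyDominates g b) : EventuallyDominates (fun F => f F ⊔ g F) (a ⊔ b) := by
  intro p hp hpab
  by_cases ha : p ≤ a
  · exact (hf p hp ha).mono fun F h => h.trans le_sup_left
  by_cases hb : p ≤ b
  · exact (hg p hp hb).mono fun F h => h.trans le_sup_right
  obtain ⟨q, r, hq, hr, hqa, hrb, hpqr⟩ := exists_atoms_of_le_sup hp hpab ha hb
  filter_upwards [hf q hq hqa, hg r hr hrb] with F hfF hgF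
  exact hpqr.trans (sup_le_sup hfF hgF)

end EventuallyDominates

variable {N : Type u} [ModularOrtholattice N]

/-- The assignment `v` cut down to the interval below `u`. -/
def truncate (v : ℕ → N) (u : N) (n : ℕ) : Set.Iic u := ⟨u ⊓ v n, inf_le_left⟩

theorem eventuallyDominates_eval (v : ℕ → N) (t : OrthoTerm) :
    EventuallyDominates (fun F => (t.eval (truncate v (F.sup Subtype.val))).1) (t.eval v) ∧
    EventuallyDominates (fun F => (t.compl.eval (truncate v (F.sup Subtype.val))).1)
      (t.compl.eval v) := by
  have hcut := eventuallyDominates_sup_inf (N := N)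
  induction t with
  | var n =>
    exact ⟨hcut _, (hcut _).mono fun F => inf_le_inf_left _ <|
      Ortholattice.compl_le_compl inf_le_right⟩
  | zero =>
    simp only [OrthoTerm.eval, Ortholattice.compl_bot]
    exact ⟨fun p hp h => absurd (le_bot_iff.1 h) hp.1, (hcut _).mono fun F => inf_le_left⟩
  | one =>
    simp only [OrthoTerm.eval, Ortholattice.compl_top]
    exact ⟨(hcut _).mono fun F => inf_le_left, fun p hp h => absurd (le_bot_iff.1 h) hp.1⟩
  | join s t hs ht =>
    simp only [OrthoTerm.eval, Ortholattice.compl_sup] at hs ht ⊢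
    exact ⟨hs.1.sup ht.1, hs.2.inf ht.2⟩
  | meet s t hs ht =>
    simp only [OrthoTerm.eval, Ortholattice.compl_inf] at hs ht ⊢
    exact ⟨hs.1.inf ht.1, hs.2.sup ht.2⟩
  | compl s hs =>
    simp only [OrthoTerm.eval, Ortholattice.compl_compl_self] at hs ⊢
    exact hs.symm

theorem satisfies_zero_of_isAtomic [IsAtomic N] {t : OrthoTerm}
    (ht : ∀ (M : Type u) [ModularOrtholattice M], IsFiniteDimensional M → Satisfies M t .zero) :
    Satisfies N t .zero := by
  refine fun v => (eq_bot_or_exists_atom_le (t.eval v)).resolve_right ?_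
  rintro ⟨p, hp, hpt⟩
  obtain ⟨F, hF⟩ := ((eventuallyDominates_eval v t).1 p hp hpt).exists
  have htF := ht _ (isFiniteDimensional_Iic_finset_sup Subtype.prop F)
    (truncate v (F.sup Subtype.val))
  exact hp.1 (le_bot_iff.1 (hF.trans_eq (congrArg Subtype.val htF)))

theorem IsProatomic.of_isAtomic [IsAtomic N] : IsProatomic N := fun _ _ hst =>
  satisfies_iff_excess.2
    ⟨satisfies_zero_of_isAtomic fun M _ hM => (satisfies_iff_excess.1 (hst M hM)).1,
      satisfies_zero_of_isAtomic fun M _ hM => (satisfies_iff_excess.1 (hst M hM)).2⟩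

end Truncation

theorem HasAtomicExtension.isProatomic {L : Type u} [ModularOrtholattice L]
    (h : HasAtomicExtension L) : IsProatomic L := by
  obtain ⟨N, _, f, _, hinj, hcompl⟩ := h
  refine fun s t hst v => hinj ?_
  rw [OrthoTerm.eval_map f hcompl, OrthoTerm.eval_map f hcompl]
  exact IsProatomic.of_isAtomic s t hst _

/-! ### Proatomic lattices as subquotients of atomic ones -/

/-- Substitution of variables for variables. -/
def OrthoTerm.rename (f : ℕ → ℕ) : OrthoTerm → OrthoTerm
  | .var n => .var (f n)
  | .zero => .zero
  | .one => .one
  | .join s t => .join (s.rename f) (t.rename f)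
  | .meet s t => .meet (s.rename f) (t.rename f)
  | .compl s => .compl (s.rename f)

theorem OrthoTerm.eval_rename {L : Type*} [Ortholattice L] (f : ℕ → ℕ) (v : ℕ → L)
    (t : OrthoTerm) : (t.rename f).eval v = t.eval (v ∘ f) := by
  induction t with
  | var n => rfl
  | zero => rfl
  | one => rfl
  | join s t hs ht => simp only [rename, eval, hs, ht]
  | meet s t hs ht => simp only [rename, eval, hs, ht]
  | compl s hs => simp only [rename, eval, hs]

/-- `R` is the graph of a surjective homomorphism onto `L` from a subalgebra of `N`. -/
structure IsSubquotientRel {N L : Type*} [Ortholattice N] [Ortholattice L] (R : N → L → Prop) :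
    Prop where
  sup : ∀ {x y a b}, R x a → R y b → R (x ⊔ y) (a ⊔ b)
  compl : ∀ {x a}, R x a → R xᶜ aᶜ
  exists_rel : ∀ a, ∃ x, R x a
  eq_bot : ∀ {a}, R ⊥ a → a = ⊥

namespace IsSubquotientRel

variable {N L : Type*} [Ortholattice N] [Ortholattice L] {R : N → L → Prop} {a b : L} {x y : N}

theorem inf (h : IsSubquotientRel R) (hx : R x a) (hy : R y b) : R (x ⊓ y) (a ⊓ b) := by
  simpa only [Ortholattice.compl_sup, Ortholattice.compl_compl_self]
    using h.compl (h.sup (h.compl hx) (h.compl hy))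

theorem excess (h : IsSubquotientRel R) (hx : R x a) (hy : R y b) :
    R (Ortholattice.excess x y) (Ortholattice.excess a b) :=
  h.inf hx (h.compl (h.inf hx hy))

theorem bot (h : IsSubquotientRel R) : R ⊥ ⊥ := by
  obtain ⟨x, hx⟩ := h.exists_rel ⊥
  simpa only [Ortholattice.inf_compl_self] using h.inf hx (h.compl hx)

theorem top (h : IsSubquotientRel R) : R ⊤ ⊤ := by
  simpa only [Ortholattice.compl_bot] using h.compl h.bot

end IsSubquotientRel

theorem Satisfies.of_pi {ι : Type*} {M : ι → Type*} [∀ i, ModularOrtholattice (M i)]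
    {s t : OrthoTerm} (h : Satisfies (∀ i, M i) s t) {i : ι} : Satisfies (M i) s t := fun v => by
  classical
  simpa only [OrthoTerm.eval_pi, Function.update_self]
    using congrFun (h fun n => Function.update ⊥ i (v n)) i

/-- Birkhoff's theorem for the class `{M}`: the values of terms at the evaluations
`(L → M) → M` form the free algebra over `L` in the variety generated by `M`. -/
theorem exists_isSubquotientRel_of_satisfies {L M : Type*} [ModularOrtholattice L]
    [ModularOrtholattice M]
    (h : ∀ t : OrthoTerm, Satisfies M t .zero → Satisfies L t .zero) :
    ∃ R : ((L → M) → M) → L → Prop, IsSubquotientRel R := by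
  refine ⟨fun x a => ∃ (t : OrthoTerm) (c : ℕ → L),
    t.eval c = a ∧ t.eval (fun n w => w (c n)) = x, ?_, ?_, ?_, ?_⟩
  · rintro _ _ _ _ ⟨s, c, rfl, rfl⟩ ⟨t, d, rfl, rfl⟩
    let e := Equiv.natSumNatEquivNat
    refine ⟨.join (s.rename (e ∘ Sum.inl)) (t.rename (e ∘ Sum.inr)), Sum.elim c d ∘ e.symm,
      ?_, ?_⟩ <;>
    simp only [OrthoTerm.eval, OrthoTerm.eval_rename, Function.comp_def, Equiv.symm_apply_apply,
      Sum.elim_inl, Sum.elim_inr]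
  · rintro _ _ ⟨t, c, rfl, rfl⟩
    exact ⟨.compl t, c, rfl, rfl⟩
  · exact fun a => ⟨_, .var 0, fun _ => a, rfl, rfl⟩
  · rintro _ ⟨t, c, rfl, htc⟩
    have hvanish (w : L → M) : t.eval (w ∘ c) = ⊥ :=
      (OrthoTerm.eval_pi _ t w).symm.trans (congrFun htc w)
    have hrename : Satisfies M (t.rename (Function.invFun c ∘ c)) .zero := fun u =>
      (t.eval_rename _ u).trans (hvanish (u ∘ Function.invFun c))
    have hcomp : c ∘ Function.invFun c ∘ c = c :=
      funext fun n => Function.invFun_eq ⟨n, rfl⟩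
    simpa only [OrthoTerm.eval_rename, hcomp, OrthoTerm.eval] using h _ hrename c

theorem IsProatomic.exists_isAtomic_of_satisfies {L : Type u} [ModularOrtholattice L]
    (h : IsProatomic L) : ∃ (M : Type u) (_ : ModularOrtholattice M), IsAtomic M ∧
      ∀ t : OrthoTerm, Satisfies M t .zero → Satisfies L t .zero := by
  let I := {t : OrthoTerm // ∃ (M : Type u) (_ : ModularOrtholattice M),
    IsFiniteDimensional M ∧ ¬ Satisfies M t .zero}
  choose M _ hM ht using fun t : I => t.2
  have := fun t => (hM t).isAtomic
  refine ⟨∀ t, M t, inferInstance, inferInstance, fun t hsat => h t .zero fun K _ hK => ?_⟩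
  by_contra hne
  exact ht ⟨t, K, _, hK, hne⟩ hsat.of_pi

theorem IsProatomic.exists_isSubquotientRel {L : Type u} [ModularOrtholattice L]
    (h : IsProatomic L) : ∃ (N : Type u) (_ : ModularOrtholattice N) (R : N → L → Prop),
      IsAtomic N ∧ IsSubquotientRel R := by
  obtain ⟨M, _, _, hM⟩ := h.exists_isAtomic_of_satisfies
  obtain ⟨R, hR⟩ := exists_isSubquotientRel_of_satisfies hM
  exact ⟨_, _, R, inferInstance, hR⟩

/-! ### Ultrapowers -/

section Germ

open Filter

instance germModularOrtholattice {ι N : Type*} (l : Filter ι) [ModularOrtholattice N] :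
    ModularOrtholattice (l.Germ N) where
  compl := Germ.map (·ᶜ)
  sup_compl_self x := x.inductionOn fun f => congrArg Germ.ofFun
    (funext fun i => Ortholattice.sup_compl_self (f i))
  inf_compl_self x := x.inductionOn fun f => congrArg Germ.ofFun
    (funext fun i => Ortholattice.inf_compl_self (f i))
  compl_compl_self x := x.inductionOn fun f => congrArg Germ.ofFun
    (funext fun i => Ortholattice.compl_compl_self (f i))
  compl_antitone x y := x.inductionOn₂ y fun _ _ h =>
    Germ.coe_le.2 ((Germ.coe_le.1 h).mono fun _ => Ortholattice.compl_le_compl)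
  sup_inf_le_assoc_of_le {x} y z := x.inductionOn₃ y z fun _ g _ h =>
    Germ.coe_le.2 ((Germ.coe_le.1 h).mono fun i => IsModularLattice.sup_inf_le_assoc_of_le (g i))

theorem isAtom_germ {ι N : Type*} {U : Ultrafilter ι} [PartialOrder N] [OrderBot N] {f : ι → N}
    (h : ∀ᶠ i in U, IsAtom (f i)) : IsAtom (f : Germ (U : Filter ι) N) := by
  refine ⟨fun hf => ?_, fun x => x.inductionOn fun g hg => Germ.coe_eq.2 ?_⟩
  · obtain ⟨i, hi, hi'⟩ := (h.and (Germ.coe_eq.1 hf)).exists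
    exact hi.1 hi'
  · filter_upwards [h, Germ.coe_lt.1 hg] with i hi hlt using hi.2 _ hlt

theorem germ_isAtomic {ι N : Type*} (U : Ultrafilter ι) [PartialOrder N] [OrderBot N]
    [IsAtomic N] : IsAtomic (Germ (U : Filter ι) N) := by
  refine ⟨fun x => x.inductionOn fun f => ?_⟩
  by_cases hf : ∀ᶠ i in U, f i = ⊥
  · exact .inl (Germ.coe_eq.2 hf)
  · rw [← Ultrafilter.eventually_not] at hf
    choose! q hq using fun i => (eq_bot_or_exists_atom_le (f i)).resolve_left
    exact .inr ⟨(q : Germ (U : Filter ι) N), isAtom_germ (hf.mono fun i h => (hq i h).1),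
      Germ.coe_le.2 (hf.mono fun i h => (hq i h).2)⟩

end Germ

/-! ### The projective space of an ideal -/

namespace ProjSubspace

variable {P : Type*} [ProjectiveSpace P] {U : ProjSubspace P} {p : P}

theorem point_le : point p ≤ U ↔ p ∈ U :=
  ⟨fun h => h rfl, fun h _ hq => hq ▸ h⟩

end ProjSubspace

theorem Orthogonality.mem_orth_point {P : Type*} [ProjectiveSpace P] {o : Orthogonality P}
    {p q : P} : q ∈ o.orth (ProjSubspace.point p) ↔ o.Perp p q :=
  ⟨fun h => h p rfl, fun h _ hr => hr ▸ h⟩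

section AtomsCollinear

variable {M : Type*} [Lattice M] {p q r s t : M}

/-- Three distinct elements, in the application atoms of a modular lattice, lie on a line. -/
structure AtomsCollinear (p q r : M) : Prop where
  ne₁₂ : p ≠ q
  ne₂₃ : q ≠ r
  ne₃₁ : r ≠ p
  le_sup : r ≤ p ⊔ q

namespace AtomsCollinear

theorem swap (h : AtomsCollinear p q r) : AtomsCollinear q p r :=
  ⟨h.ne₁₂.symm, h.ne₃₁.symm, h.ne₂₃.symm, sup_comm p q ▸ h.le_sup⟩

variable [OrderBot M] [IsModularLattice M]

theorem rotate (hp : IsAtom p) (hq : IsAtom q) (hr : IsAtom r) (h : AtomsCollinear p q r) :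
    AtomsCollinear q r p :=
  ⟨h.ne₂₃, h.ne₃₁, h.ne₁₂, le_sup_of_le_sup_of_not_le hp h.swap.le_sup fun hrq =>
    h.ne₂₃.symm ((hq.le_iff_eq hr.1).1 hrq)⟩

theorem isAtom_inf_sup_of_triangle (hp : IsAtom p) (hq : IsAtom q) (hr : IsAtom r)
    (hs : IsAtom s) (ht : IsAtom t) (hpsq : AtomsCollinear p s q) (hqtr : AtomsCollinear q t r)
    (hpr : p ≠ r) (hpqr : ¬ AtomsCollinear p q r) :
    IsAtom ((p ⊔ r) ⊓ (s ⊔ t)) ∧ AtomsCollinear p r ((p ⊔ r) ⊓ (s ⊔ t)) ∧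
      AtomsCollinear s t ((p ⊔ r) ⊓ (s ⊔ t)) := by
  have hp_le : p ≤ s ⊔ q := (hpsq.rotate hp hs hq).le_sup
  have hs_le : s ≤ q ⊔ p := ((hpsq.rotate hp hs hq).rotate hs hq hp).le_sup
  have hq_le : q ≤ t ⊔ r := (hqtr.rotate hq ht hr).le_sup
  have ht_le : t ≤ r ⊔ q := ((hqtr.rotate hq ht hr).rotate ht hr hq).le_sup
  have hr_not_le : ¬ r ≤ q ⊔ p := fun h =>
    hpqr (AtomsCollinear.mk hpsq.ne₃₁ hpr hqtr.ne₃₁ h).swap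
  have hp_not_le : ¬ p ≤ r ⊔ q := fun h =>
    hpqr ((AtomsCollinear.mk hqtr.ne₃₁ hpsq.ne₃₁ hpr h).swap.rotate hq hr hp |>.rotate hr hp hq)
  have hq_not_le : ¬ q ≤ p ⊔ r := fun h =>
    hpqr ((AtomsCollinear.mk hpr hqtr.ne₃₁ hpsq.ne₃₁ h).swap.rotate hr hp hq)
  have hs_not_le : ¬ s ≤ p ⊔ r := fun h => hq_not_le (hpsq.le_sup.trans (sup_le le_sup_left h))
  have ht_not_le : ¬ t ≤ p ⊔ r := fun h => hq_not_le (hq_le.trans (sup_le h le_sup_right))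
  have hp_not_le' : ¬ p ≤ s ⊔ t := fun h =>
    have ht_le' : t ≤ s ⊔ p := le_sup_of_le_sup_of_not_le ht h fun hps =>
      hs_not_le (((hs.le_iff_eq hp.1).1 hps).ge.trans le_sup_left)
    hr_not_le <| hqtr.le_sup.trans <| sup_le le_sup_left (ht_le'.trans (sup_le hs_le le_sup_right))
  have hr_not_le' : ¬ r ≤ s ⊔ t := fun h =>
    have hs_le' : s ≤ t ⊔ r := le_sup_of_le_sup_of_not_le hs (sup_comm s t ▸ h) fun hrt =>
      ht_not_le (((ht.le_iff_eq hr.1).1 hrt).ge.trans le_sup_right)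
    hp_not_le <| hp_le.trans <| sup_le (hs_le'.trans (sup_le ht_le le_sup_left)) le_sup_right
  have hst : t ≠ s := fun h => hp_not_le (hp_le.trans (sup_le (h ▸ ht_le) le_sup_right))
  have hts : t ≤ s ⊔ (p ⊔ r) := ht_le.trans <| sup_le (le_sup_right.trans le_sup_right) <|
    hpsq.le_sup.trans (sup_le (le_sup_left.trans le_sup_right) le_sup_left)
  exact ⟨isAtom_inf_sup hs ht hts hst hs_not_le,
    ⟨hpr, fun h => hr_not_le' (h ▸ inf_le_right), fun h => hp_not_le' (h ▸ inf_le_right),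
      inf_le_left⟩,
    ⟨hst.symm, fun h => ht_not_le (h ▸ inf_le_left), fun h => hs_not_le (h ▸ inf_le_left),
      inf_le_right⟩⟩

end AtomsCollinear

end AtomsCollinear

/-- The atoms of `M` that belong to the ideal `J`. Collinearity makes them the points of a
projective space. -/
def AtomsIn {M : Type*} [Lattice M] [OrderBot M] (J : Order.Ideal M) : Type _ :=
  {p : M // IsAtom p ∧ p ∈ J}

namespace AtomsIn

open ProjSubspace (point point_le)

section Modular

variable {M : Type*} [Lattice M] [OrderBot M] {J : Order.Ideal M}

theorem isAtom (p : AtomsIn J) : IsAtom p.1 := p.2.1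

variable [IsModularLattice M]

instance : ProjectiveSpace (AtomsIn J) where
  Collinear p q r := AtomsCollinear p.1 q.1 r.1
  ne_of_collinear h h' := h.ne₁₂ (congrArg Subtype.val h')
  collinear_swap := AtomsCollinear.swap
  collinear_rotate {p q r} := AtomsCollinear.rotate p.isAtom q.isAtom r.isAtom
  triangle {p q r s t} hs ht hpr hpqr := by
    obtain ⟨hu, hpru, hstu⟩ := AtomsCollinear.isAtom_inf_sup_of_triangle p.isAtom q.isAtom
      r.isAtom s.isAtom t.isAtom hs ht (Subtype.coe_ne_coe.2 hpr) hpqr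
    refine ⟨⟨_, hu, J.lower inf_le_left (J.sup_mem p.2.2 r.2.2)⟩, ⟨hpru, hstu⟩, fun x hx => ?_⟩
    exact Subtype.ext ((hu.le_iff_eq x.isAtom.1).1 (le_inf hx.1.le_sup hx.2.le_sup))

variable {p q r : AtomsIn J} {a b : M}

theorem mem_of_le_sup {X : ProjSubspace (AtomsIn J)} (hq : q ∈ X) (hr : r ∈ X)
    (h : p.1 ≤ q.1 ⊔ r.1) : p ∈ X := by
  by_cases hqr : q.1 = r.1
  · rw [hqr, sup_idem, r.isAtom.le_iff_eq p.isAtom.1] at h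
    exact Subtype.ext h ▸ hr
  by_cases hpq : p.1 = q.1
  · exact Subtype.ext hpq ▸ hq
  by_cases hrp : r.1 = p.1
  · exact Subtype.ext hrp ▸ hr
  exact X.closed hq hr ⟨hqr, hrp, hpq, h⟩

/-- The subspace of the points below `a`. -/
def below (J : Order.Ideal M) (a : M) : ProjSubspace (AtomsIn J) where
  carrier := {p | p.1 ≤ a}
  closed hp hq h := h.le_sup.trans (sup_le hp hq)

theorem mem_below : p ∈ below J a ↔ p.1 ≤ a := Iff.rfl

end Modular

variable {M : Type*} [ModularOrtholattice M] {J : Order.Ideal M}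

/-- The orthogonality induced by the orthocomplementation of `M`. -/
def orthogonality (J : Order.Ideal M) : Orthogonality (AtomsIn J) where
  Perp p q := p.1 ≤ q.1ᶜ
  symm := Ortholattice.le_compl_comm.1
  perp_of_le_sup {p q r s} hq hr hs := by
    have hqr : point q ⊔ point r ≤ below J p.1ᶜ :=
      sup_le (point_le.2 (Ortholattice.le_compl_comm.1 hq))
        (point_le.2 (Ortholattice.le_compl_comm.1 hr))
    exact Ortholattice.le_compl_comm.1 (point_le.1 (hs.trans hqr))

theorem isAnisotropic : (orthogonality J).IsAnisotropic := fun p hp =>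
  p.isAtom.1 (Ortholattice.eq_bot_of_le_of_le_compl le_rfl hp)

theorem orth_point (p : AtomsIn J) : (orthogonality J).orth (point p) = below J p.1ᶜ :=
  SetLike.ext fun _ => Orthogonality.mem_orth_point.trans Ortholattice.le_compl_comm

theorem isPolarity : (orthogonality J).IsPolarity := by
  refine ⟨fun p => ⟨p, isAnisotropic p⟩, fun p => ?_⟩
  rw [orth_point]
  refine ⟨fun h => isAnisotropic p (show p ∈ below J p.1ᶜ from h ▸ trivial), fun X hX => ?_⟩
  obtain ⟨q, hqX, hqp⟩ := SetLike.exists_of_lt hX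
  rw [mem_below] at hqp
  refine top_le_iff.1 fun r _ => ?_
  by_cases hrp : r.1 ≤ p.1ᶜ
  · exact hX.le hrp
  by_cases hrq : r.1 = q.1
  · exact Subtype.ext hrq ▸ hqX
  have hcoatom := (Ortholattice.isCompl_compl p.1).isAtom_iff_isCoatom.1 p.isAtom
  have hle : r.1 ≤ q.1 ⊔ p.1ᶜ :=
    le_top.trans_eq (hcoatom.not_le_iff_codisjoint.1 hqp).symm.eq_top.symm
  let s : AtomsIn J := ⟨p.1ᶜ ⊓ (q.1 ⊔ r.1), isAtom_inf_sup q.isAtom r.isAtom hle hrq hqp,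
    J.lower inf_le_right (J.sup_mem q.2.2 r.2.2)⟩
  have hsX : s ∈ X := hX.le (inf_le_left : s.1 ≤ p.1ᶜ)
  exact mem_of_le_sup hqX hsX (le_sup_right.trans_eq (sup_inf_sup_of_le_sup hle).symm)

end AtomsIn

/-! ### Representations by the atoms in an ideal -/

/-- The conditions on an ideal `J` under which the atoms in `J` represent `L` geometrically: the
kernel of `R` is orthogonal to `J`, while `J` is large enough to decompose its elements along
joins and to distinguish the elements of `L`. -/
structure IsRepresenting {M L : Type*} [ModularOrtholattice M] [ModularOrtholattice L]
    (R : M → L → Prop) (J : Order.Ideal M) : Prop extends IsSubquotientRel R where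
  le_compl : ∀ {z y}, R z ⊥ → y ∈ J → y ≤ zᶜ
  le_sup_inf : ∀ {x y a b w}, R x a → R y b → w ∈ J → w ≤ x ⊔ y →
    ∃ w' ∈ J, w ≤ x ⊓ w' ⊔ y ⊓ w'
  exists_ne_bot : ∀ {x a}, R x a → a ≠ ⊥ → ∃ w ∈ J, w ≠ ⊥ ∧ w ≤ x

namespace IsRepresenting

open AtomsIn

variable {M L : Type*} [ModularOrtholattice M] [ModularOrtholattice L] {R : M → L → Prop}
  {J : Order.Ideal M} {a b : L} {x y w : M}

theorem le_of_rel (h : IsRepresenting R J) (hx : R x a) (hy : R y b) (hab : a ≤ b) (hw : w ∈ J)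
    (hwx : w ≤ x) : w ≤ y :=
  Ortholattice.le_of_le_of_le_compl_excess hwx <| h.le_compl
    (Ortholattice.excess_eq_bot_of_le hab ▸ h.excess hx hy) hw

theorem below_le_below (h : IsRepresenting R J) (hx : R x a) (hy : R y b) (hab : a ≤ b) :
    below J x ≤ below J y := fun p hp => h.le_of_rel hx hy hab p.2.2 hp

theorem below_eq_below (h : IsRepresenting R J) (hx : R x a) (hy : R y a) :
    below J x = below J y :=
  (h.below_le_below hx hy le_rfl).antisymm (h.below_le_below hy hx le_rfl)

theorem below_sup (h : IsRepresenting R J) (hx : R x a) (hy : R y b) :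
    below J (x ⊔ y) = below J x ⊔ below J y := by
  refine le_antisymm (fun p hp => ?_) (sup_le (fun p hp => le_sup_of_le_left hp)
    fun p hp => le_sup_of_le_right hp)
  obtain ⟨w, hw, hpw⟩ := h.le_sup_inf hx hy p.2.2 hp
  by_cases hpx : p.1 ≤ x ⊓ w
  · exact (le_sup_left : below J x ≤ _) (hpx.trans inf_le_left)
  by_cases hpy : p.1 ≤ y ⊓ w
  · exact (le_sup_right : below J y ≤ _) (hpy.trans inf_le_left)
  obtain ⟨q, r, hq, hr, hqx, hry, hpqr⟩ := exists_atoms_of_le_sup p.isAtom hpw hpx hpy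
  let q' : AtomsIn J := ⟨q, hq, J.lower (hqx.trans inf_le_right) hw⟩
  let r' : AtomsIn J := ⟨r, hr, J.lower (hry.trans inf_le_right) hw⟩
  have hq' : q' ∈ below J x := hqx.trans inf_le_left
  have hr' : r' ∈ below J y := hry.trans inf_le_left
  exact mem_of_le_sup ((le_sup_left : below J x ≤ _) hq') ((le_sup_right : below J y ≤ _) hr') hpqr

theorem le_of_below_le_below [IsAtomic M] (h : IsRepresenting R J) (hx : R x a) (hy : R y b)
    (hle : below J x ≤ below J y) : a ≤ b := by
  by_contra hab
  obtain ⟨w, hw, hw_ne, hwx⟩ := h.exists_ne_bot (h.excess hx hy)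
    (mt Ortholattice.excess_eq_bot.1 hab)
  obtain ⟨p, hp, hpw⟩ := (eq_bot_or_exists_atom_le w).resolve_left hw_ne
  have hpx : p ≤ x := (hpw.trans hwx).trans inf_le_left
  let p' : AtomsIn J := ⟨p, hp, J.lower hpw hw⟩
  have hpy : p ≤ y := hle (show p' ∈ below J x from hpx)
  exact hp.1 (Ortholattice.eq_bot_of_le_of_le_compl (le_inf hpx hpy)
    ((hpw.trans hwx).trans inf_le_right))

theorem hasGeometricRepresentation {M L : Type u} [ModularOrtholattice M]
    [ModularOrtholattice L] [IsAtomic M] {R : M → L → Prop} {J : Order.Ideal M}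
    (h : IsRepresenting R J) : HasGeometricRepresentation L := by
  choose g hg using h.exists_rel
  let η : BoundedLatticeHom L (ProjSubspace (AtomsIn J)) :=
    { toFun a := below J (g a)
      map_sup' a b := (h.below_eq_below (hg _) (h.sup (hg a) (hg b))).trans
        (h.below_sup (hg a) (hg b))
      map_inf' a b := (h.below_eq_below (hg _) (h.inf (hg a) (hg b))).trans
        (SetLike.ext fun _ => le_inf_iff)
      map_top' := (h.below_eq_below (hg _) h.top).trans (top_le_iff.1 fun _ _ => le_top)
      map_bot' := (h.below_eq_below (hg _) h.bot).trans <|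
        le_bot_iff.1 fun p hp => p.isAtom.1 (le_bot_iff.1 hp) }
  refine ⟨AtomsIn J, inferInstance, orthogonality J, η, isPolarity, isAnisotropic,
    fun a b hab => ?_, fun a p hp q hq => ?_⟩
  · exact (h.le_of_below_le_below (hg a) (hg b) hab.le).antisymm
      (h.le_of_below_le_below (hg b) (hg a) hab.ge)
  · have hq' : q.1 ≤ (g a)ᶜ := h.le_of_rel (hg _) (h.compl (hg a)) le_rfl q.2.2 hq
    exact (show p.1 ≤ g a from hp).trans (Ortholattice.le_compl_comm.1 hq')

end IsRepresenting

/-! ### Slow cuts -/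

section Chain

variable {K : Type*} [SemilatticeSup K] [OrderBot K]

/-- The chain `c₀ = ⊥`, `cₙ₊₁ = cₙ ⊔ φ cₙ`. For `φ` large, it grows as fast as needed. -/
def chain (φ : K → K) (n : ℕ) : K := (id ⊔ φ)^[n] ⊥

theorem chain_mono (φ : K → K) : Monotone (chain φ) := fun _ _ hmn =>
  Function.monotone_iterate_of_id_le (le_sup_left : id ≤ id ⊔ φ) hmn ⊥

theorem le_chain_succ (φ : K → K) (n : ℕ) : φ (chain φ n) ≤ chain φ (n + 1) := by
  rw [chain, chain, Function.iterate_succ_apply']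
  exact le_sup_right

end Chain

namespace IsSubquotientRel

open Filter

variable {N L : Type*} [ModularOrtholattice N] [ModularOrtholattice L] {R : N → L → Prop}

/-- The elements of `N` that are mapped to `⊥ : L`. -/
def Kernel (_ : IsSubquotientRel R) : Type _ := {z : N // R z ⊥}

variable (h : IsSubquotientRel R) {a b : L} {x y : N}

instance : SemilatticeSup h.Kernel :=
  Subtype.semilatticeSup fun _ _ hx hy => sup_idem (⊥ : L) ▸ h.sup hx hy

instance : OrderBot h.Kernel := Subtype.orderBot h.bot

/-- The index set of the ultrapower: a growth function on the kernel, and a height. -/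
abbrev Index : Type _ := (h.Kernel → h.Kernel) × ℕ

/-- An ultrafilter on the indices whose growth functions exceed any given one eventually, and
whose heights tend to infinity. -/
noncomputable def indexUltrafilter : Ultrafilter h.Index := .of atTop

theorem eventually_le_growth (φ : h.Kernel → h.Kernel) :
    ∀ᶠ i : h.Index in h.indexUltrafilter, φ ≤ i.1 :=
  Ultrafilter.of_le _ ((eventually_ge_atTop (φ, 0)).mono fun _ hi => hi.1)

theorem tendsto_height :
    Tendsto (Prod.snd : h.Index → ℕ) h.indexUltrafilter atTop :=
  (tendsto_snd.mono_left prod_atTop_atTop_eq.ge).mono_left (Ultrafilter.of_le _)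

/-- The ultrapower of `N`. -/
abbrev Ultrapower : Type _ := Germ (h.indexUltrafilter : Filter h.Index) N

/-- The relation between the ultrapower and `L` that the diagonal embedding of `N` induces. -/
def ultrapowerRel (x : h.Ultrapower) (a : L) : Prop := ∃ z : N, x = (z : h.Ultrapower) ∧ R z a

/-- The complement of the `n`-th element of the chain in the kernel that the growth function
of `i` generates. -/
def cut (i : h.Index) (n : ℕ) : N := (chain i.1 n).1ᶜ

theorem cut_anti (i : h.Index) : Antitone (h.cut i) := fun _ _ hmn =>
  Ortholattice.compl_le_compl (chain_mono i.1 hmn)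

theorem rel_inf_cut (hx : R x a) (i : h.Index) (n : ℕ) : R (x ⊓ h.cut i n) a := by
  simpa only [cut, Ortholattice.compl_bot, inf_top_eq] using h.inf hx (h.compl (chain i.1 n).2)

/-- The elements of the ultrapower below a cut whose height tends to infinity. The height may tend
to infinity arbitrarily slowly, so passing to the previous cut does not leave the ideal. -/
def slowIdeal : Order.Ideal h.Ultrapower where
  carrier := {w | ∃ k : h.Index → ℕ, Tendsto k h.indexUltrafilter atTop ∧
    w ≤ ((fun i => h.cut i (k i) : h.Index → N) : h.Ultrapower)}
  lower' _ _ hle := fun ⟨k, hk, hw⟩ => ⟨k, hk, hle.trans hw⟩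
  nonempty' := ⟨_, Prod.snd, h.tendsto_height, le_rfl⟩
  directed' := by
    rintro v ⟨k, hk, hv⟩ w ⟨l, hl, hw⟩
    have hkl : Tendsto (fun i => min (k i) (l i)) h.indexUltrafilter atTop :=
      tendsto_atTop.2 fun n => (hk.eventually_ge_atTop n).mp <|
        (hl.eventually_ge_atTop n).mono fun _ h₁ h₂ => le_min h₂ h₁
    exact ⟨_, ⟨_, hkl, le_rfl⟩,
      hv.trans (Germ.coe_le.2 (.of_forall fun i => h.cut_anti i (min_le_left _ _))),
      hw.trans (Germ.coe_le.2 (.of_forall fun i => h.cut_anti i (min_le_right _ _)))⟩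

theorem coe_mem_slowIdeal {f : h.Index → N} : (f : h.Ultrapower) ∈ h.slowIdeal ↔
    ∃ k : h.Index → ℕ, Tendsto k h.indexUltrafilter atTop ∧
      ∀ᶠ i in h.indexUltrafilter, f i ≤ h.cut i (k i) := Iff.rfl

theorem ultrapowerRel_isSubquotientRel : IsSubquotientRel h.ultrapowerRel where
  sup := by
    rintro _ _ a b ⟨x, rfl, hx⟩ ⟨y, rfl, hy⟩
    exact ⟨x ⊔ y, rfl, h.sup hx hy⟩
  compl := by
    rintro _ a ⟨x, rfl, hx⟩
    exact ⟨xᶜ, rfl, h.compl hx⟩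
  exists_rel a := (h.exists_rel a).imp' _ fun x hx => ⟨x, rfl, hx⟩
  eq_bot := by
    rintro a ⟨x, hx, hxa⟩
    obtain rfl : ⊥ = x := Germ.const_inj.1 hx
    exact h.eq_bot hxa

theorem le_compl_of_mem_slowIdeal {z w : h.Ultrapower} (hz : h.ultrapowerRel z ⊥)
    (hw : w ∈ h.slowIdeal) : w ≤ zᶜ := by
  obtain ⟨z, rfl, hz⟩ := hz
  induction w using Germ.inductionOn with | _ f
  obtain ⟨k, hk, hf⟩ := h.coe_mem_slowIdeal.1 hw
  refine Germ.coe_le.2 ?_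
  filter_upwards [hf, hk.eventually_ge_atTop 1, h.eventually_le_growth fun _ => ⟨z, hz⟩]
    with i hfi hki hi
  exact hfi.trans <| Ortholattice.compl_le_compl <|
    ((hi ⊥).trans (le_chain_succ i.1 0)).trans (chain_mono i.1 hki)

/-- The part of `x ⊔ y` lost by cutting both `x` and `y` with `cᶜ`. -/
def cutLoss (hx : R x a) (hy : R y b) (c : h.Kernel) : h.Kernel :=
  ⟨Ortholattice.excess (x ⊔ y) (x ⊓ c.1ᶜ ⊔ y ⊓ c.1ᶜ), by
    have hc : R c.1ᶜ ⊤ := Ortholattice.compl_bot (L := L) ▸ h.compl c.2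
    simpa only [inf_top_eq, Ortholattice.excess_eq_bot_of_le le_rfl]
      using h.excess (h.sup hx hy) (h.sup (h.inf hx hc) (h.inf hy hc))⟩

theorem le_sup_inf_cut {x y w : N} (hx : R x a) (hy : R y b) {i : h.Index} {n : ℕ}
    (hi : h.cutLoss hx hy ≤ i.1) (hw : w ≤ h.cut i (n + 1)) (hle : w ≤ x ⊔ y) :
    w ≤ x ⊓ h.cut i n ⊔ y ⊓ h.cut i n :=
  Ortholattice.le_of_le_of_le_compl_excess hle <| hw.trans <|
    Ortholattice.compl_le_compl ((hi (chain i.1 n)).trans (le_chain_succ i.1 n))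

theorem exists_le_sup_inf_of_mem_slowIdeal {x y w : h.Ultrapower} (hx : h.ultrapowerRel x a)
    (hy : h.ultrapowerRel y b) (hw : w ∈ h.slowIdeal) (hle : w ≤ x ⊔ y) :
    ∃ w' ∈ h.slowIdeal, w ≤ x ⊓ w' ⊔ y ⊓ w' := by
  obtain ⟨x, rfl, hx⟩ := hx
  obtain ⟨y, rfl, hy⟩ := hy
  induction w using Germ.inductionOn with | _ f
  obtain ⟨k, hk, hf⟩ := h.coe_mem_slowIdeal.1 hw
  refine ⟨((fun i => h.cut i (k i - 1) : h.Index → N) : h.Ultrapower),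
    ⟨_, (tendsto_sub_atTop_nat 1).comp hk, le_rfl⟩, Germ.coe_le.2 ?_⟩
  filter_upwards [hf, hk.eventually_ge_atTop 1, h.eventually_le_growth (h.cutLoss hx hy),
    Germ.coe_le.1 hle] with i hfi hki hi hlei
  rw [← Nat.sub_add_cancel hki] at hfi
  exact h.le_sup_inf_cut hx hy hi hfi hlei

theorem exists_mem_slowIdeal_ne_bot {x : h.Ultrapower} (hx : h.ultrapowerRel x a) (ha : a ≠ ⊥) :
    ∃ w ∈ h.slowIdeal, w ≠ ⊥ ∧ w ≤ x := by
  obtain ⟨x, rfl, hx⟩ := hx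
  refine ⟨((fun i => x ⊓ h.cut i i.2 : h.Index → N) : h.Ultrapower),
    ⟨_, h.tendsto_height, Germ.coe_le.2 (.of_forall fun _ => inf_le_right)⟩, fun hbot => ?_,
    Germ.coe_le.2 (.of_forall fun _ => inf_le_left)⟩
  obtain ⟨i, hi : x ⊓ h.cut i i.2 = ⊥⟩ := (Germ.coe_eq.1 hbot).exists
  exact ha (h.eq_bot (hi ▸ h.rel_inf_cut hx i i.2))

theorem isRepresenting_slowIdeal : IsRepresenting h.ultrapowerRel h.slowIdeal where
  toIsSubquotientRel := h.ultrapowerRel_isSubquotientRel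
  le_compl := h.le_compl_of_mem_slowIdeal
  le_sup_inf := h.exists_le_sup_inf_of_mem_slowIdeal
  exists_ne_bot := h.exists_mem_slowIdeal_ne_bot

end IsSubquotientRel

theorem IsProatomic.hasGeometricRepresentation {L : Type u} [ModularOrtholattice L]
    (h : IsProatomic L) : HasGeometricRepresentation L := by
  obtain ⟨N, _, R, _, hR⟩ := h.exists_isSubquotientRel
  have := germ_isAtomic (N := N) hR.indexUltrafilter
  exact hR.isRepresenting_slowIdeal.hasGeometricRepresentation

/-! ### The modular lattice of subspaces -/

section Subspaces

variable {P : Type*} [ProjectiveSpace P] {X Y : ProjSubspace P} {p q r s x y z : P}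

open ProjectiveSpace

theorem collinear_trans (hr : Collinear p q r) (hs : Collinear p q s) (hne : r ≠ s) :
    Collinear p r s := by
  by_contra h
  obtain ⟨u, ⟨-, hu⟩, -⟩ := triangle (collinear_swap (collinear_rotate hr)) hs hne
    fun h' => h (collinear_swap h')
  exact ne_of_collinear hu rfl

namespace ProjSubspace

/-- The points on lines that join a point of `X` and a point of `Y`; the points of `X` and `Y` are
added because one of these subspaces may be empty. -/
def joinSet (X Y : ProjSubspace P) : Set P :=
  {r | r ∈ X ∨ r ∈ Y ∨ ∃ p ∈ X, ∃ q ∈ Y, Collinear p q r}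

theorem mem_joinSet_comm : r ∈ joinSet X Y ↔ r ∈ joinSet Y X := by
  have swap {X Y : ProjSubspace P} : r ∈ joinSet X Y → r ∈ joinSet Y X := by
    rintro (h | h | ⟨p, hp, q, hq, h⟩)
    · exact .inr (.inl h)
    · exact .inl h
    · exact .inr (.inr ⟨q, hq, p, hp, collinear_swap h⟩)
  exact ⟨swap, swap⟩

theorem mem_joinSet_of_collinear_left (hr : r ∈ joinSet X Y) (hx : x ∈ X)
    (h : Collinear r x z) : z ∈ joinSet X Y := by
  rcases hr with hr | hr | ⟨p, hp, q, hq, hpq⟩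
  · exact .inl (X.closed hr hx h)
  · exact .inr (.inr ⟨x, hx, r, hr, collinear_swap h⟩)
  have hpr : Collinear p r q := collinear_swap (collinear_rotate (collinear_rotate hpq))
  have mem_of_line (hz : Collinear p r z) : z ∈ joinSet X Y := by
    by_cases hqz : q = z
    · exact .inr (.inl (hqz ▸ hq))
    · exact .inr (.inr ⟨p, hp, q, hq, collinear_trans hpr hz hqz⟩)
  by_cases hxp : x = p
  · subst hxp
    exact mem_of_line (collinear_swap h)
  by_cases hxr : Collinear x r p
  · by_cases hzp : p = z
    · exact .inl (hzp ▸ hp)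
    · exact mem_of_line (collinear_swap (collinear_trans (collinear_swap hxr) h hzp))
  · obtain ⟨u, ⟨hu, hzu⟩, -⟩ := triangle (collinear_rotate h) (collinear_rotate hpr) hxp hxr
    exact .inr (.inr ⟨u, X.closed hx hp hu, q, hq, collinear_swap (collinear_rotate hzu)⟩)

theorem mem_joinSet_of_collinear_right (hr : r ∈ joinSet X Y) (hy : y ∈ Y)
    (h : Collinear r y z) : z ∈ joinSet X Y :=
  mem_joinSet_comm.1 (mem_joinSet_of_collinear_left (mem_joinSet_comm.1 hr) hy h)

theorem mem_joinSet_of_collinear (hr : r ∈ joinSet X Y) (hs : s ∈ joinSet X Y)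
    (h : Collinear r s z) : z ∈ joinSet X Y := by
  rcases hs with hs | hs | ⟨p, hp, q, hq, hpq⟩
  · exact mem_joinSet_of_collinear_left hr hs h
  · exact mem_joinSet_of_collinear_right hr hs h
  by_cases hrp : r = p
  · subst hrp
    exact mem_joinSet_of_collinear_left (.inr (.inr ⟨r, hp, q, hq, hpq⟩)) hp
      (collinear_swap h)
  by_cases hrsp : Collinear r s p
  · by_cases hzp : p = z
    · exact .inl (hzp ▸ hp)
    · exact mem_joinSet_of_collinear_left hr hp (collinear_trans hrsp h hzp)
  · obtain ⟨u, ⟨hu, hzu⟩, -⟩ := triangle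
      (collinear_swap (collinear_rotate (collinear_rotate h)))
      (collinear_swap (collinear_rotate hpq)) hrp hrsp
    exact mem_joinSet_of_collinear_right (mem_joinSet_of_collinear_left hr hp hu) hq
      (collinear_swap (collinear_rotate hzu))

theorem mem_sup : r ∈ X ⊔ Y ↔ r ∈ X ∨ r ∈ Y ∨ ∃ p ∈ X, ∃ q ∈ Y, Collinear p q r := by
  constructor
  · have h : X ⊔ Y ≤ ⟨joinSet X Y, mem_joinSet_of_collinear⟩ :=
      sup_le (fun _ => .inl) (fun _ => .inr ∘ .inl)
    exact fun hr => h hr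
  · rintro (h | h | ⟨p, hp, q, hq, h⟩)
    · exact (le_sup_left : X ≤ X ⊔ Y) h
    · exact (le_sup_right : Y ≤ X ⊔ Y) h
    · exact (X ⊔ Y).closed ((le_sup_left : X ≤ X ⊔ Y) hp) ((le_sup_right : Y ≤ X ⊔ Y) hq) h

instance : IsModularLattice (ProjSubspace P) where
  sup_inf_le_assoc_of_le {X} Y {Z} hXZ r := by
    rintro ⟨hr, hrZ⟩
    rcases mem_sup.1 hr with h | h | ⟨x, hx, y, hy, h⟩
    · exact mem_sup.2 (.inl h)
    · exact mem_sup.2 (.inr (.inl ⟨h, hrZ⟩))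
    · have hyZ : y ∈ Z :=
        Z.closed (hXZ hx) hrZ (collinear_swap (collinear_rotate (collinear_rotate h)))
      exact mem_sup.2 (.inr (.inr ⟨x, hx, y, ⟨hy, hyZ⟩, h⟩))

theorem isAtom_point (p : P) : IsAtom (point p) := by
  refine ⟨fun h => (show p ∈ (⊥ : ProjSubspace P) from h ▸ (rfl : p = p)), fun X hX => ?_⟩
  refine le_bot_iff.1 fun q hq => hX.not_ge ?_
  have hqp : q = p := hX.le hq
  exact point_le.2 (hqp ▸ hq)

end ProjSubspace

end Subspaces

namespace Orthogonality

open ProjSubspace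

variable {P : Type*} [ProjectiveSpace P] {o : Orthogonality P} {X Y : ProjSubspace P} {p q : P}

/-! ### Subspaces that split the space -/

theorem le_orth_comm : X ≤ o.orth Y ↔ Y ≤ o.orth X := by
  constructor <;> exact fun h _ hp _ hq => o.symm (h hq _ hp)

theorem orth_antitone (h : X ≤ Y) : o.orth Y ≤ o.orth X :=
  fun _ hp q hq => hp q (h hq)

theorem orth_sup (X Y : ProjSubspace P) : o.orth (X ⊔ Y) = o.orth X ⊓ o.orth Y :=
  le_antisymm (le_inf (orth_antitone le_sup_left) (orth_antitone le_sup_right))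
    (le_orth_comm.1 (sup_le (le_orth_comm.1 inf_le_left) (le_orth_comm.1 inf_le_right)))

theorem inf_orth_self (ha : o.IsAnisotropic) (X : ProjSubspace P) : X ⊓ o.orth X = ⊥ :=
  le_bot_iff.1 fun p hp => ha p (hp.2 p hp.1)

/-- `X` splits if the whole space is spanned by `X` and its orthogonal subspace. -/
def Splits (o : Orthogonality P) (X : ProjSubspace P) : Prop := X ⊔ o.orth X = ⊤

theorem eq_orth_of_sup_eq_top (ha : o.IsAnisotropic) (hle : Y ≤ o.orth X) (h : X ⊔ Y = ⊤) :
    Y = o.orth X :=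
  eq_of_le_of_inf_le_of_sup_le (z := X) hle
    (by rw [inf_comm, inf_orth_self ha]; exact bot_le)
    (by rw [sup_comm Y, h]; exact le_top)

theorem Splits.orth_orth (ha : o.IsAnisotropic) (h : o.Splits X) : o.orth (o.orth X) = X :=
  (eq_orth_of_sup_eq_top ha (le_orth_comm.1 le_rfl) ((sup_comm _ _).trans h)).symm

theorem Splits.orth (ha : o.IsAnisotropic) (h : o.Splits X) : o.Splits (o.orth X) := by
  rwa [Splits, h.orth_orth ha, sup_comm]

theorem eq_point_sup_inf_orth_point (hpol : o.IsPolarity) (h : ¬ o.Perp p q) (hq : q ∈ X) :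
    X = point q ⊔ X ⊓ o.orth (point p) := by
  have htop : point q ⊔ o.orth (point p) = ⊤ := (hpol.2 p).2 _ <|
    right_lt_sup.2 fun h' => h (mem_orth_point.1 (point_le.1 h'))
  rw [inf_comm, ← sup_inf_assoc_of_le _ (point_le.2 hq), htop, top_inf_eq]

theorem inf_orth_point_of_mem_orth (hp : p ∈ o.orth X) : X ⊓ o.orth (point p) = X :=
  inf_eq_left.2 (le_orth_comm.1 (point_le.2 hp))

/-- A component of `p` in `X^⊥` does not affect the meet of `X` with `p^⊥`. -/
theorem exists_inf_orth_point_eq (hp : p ∈ o.orth X ⊔ Y) (hpX : p ∉ o.orth X) :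
    ∃ y ∈ Y, y ∈ o.orth X ⊔ point p ∧ X ⊓ o.orth (point p) = X ⊓ o.orth (point y) := by
  rcases mem_sup.1 hp with hp | hp | ⟨x, hx, y, hy, hxyp⟩
  · exact absurd hp hpX
  · exact ⟨p, hp, point_le.1 le_sup_right, rfl⟩
  have hxpy := ProjectiveSpace.collinear_swap <| ProjectiveSpace.collinear_rotate <|
    ProjectiveSpace.collinear_rotate hxyp
  have hsup : point x ⊔ point p = point x ⊔ point y :=
    le_antisymm (sup_le le_sup_left (mem_point_sup_point hxyp))
      (sup_le le_sup_left (mem_point_sup_point hxpy))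
  refine ⟨y, hy, mem_sup.2 (.inr (.inr ⟨x, hx, p, rfl, hxpy⟩)), ?_⟩
  rw [← inf_orth_point_of_mem_orth hx, inf_assoc, inf_assoc, ← orth_sup, ← orth_sup, hsup]

theorem Splits.inf_orth_point_sup_eq_top (hpol : o.IsPolarity) (ha : o.IsAnisotropic)
    (h : o.Splits X) (p : P) : X ⊓ o.orth (point p) ⊔ (o.orth X ⊔ point p) = ⊤ := by
  refine top_le_iff.1 (h.ge.trans (sup_le ?_ (le_sup_left.trans le_sup_right)))
  by_cases hpX : p ∈ o.orth X
  · rw [inf_orth_point_of_mem_orth hpX]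
    exact le_sup_left
  obtain ⟨x, hx, hx_mem, heq⟩ := exists_inf_orth_point_eq
    (show p ∈ o.orth X ⊔ X by rw [sup_comm, h]; trivial) hpX
  rw [heq, sup_comm]
  exact (eq_point_sup_inf_orth_point hpol (ha x) hx).le.trans
    (sup_le_sup_right (point_le.2 hx_mem) _)

theorem Splits.orth_inf_orth_point (hpol : o.IsPolarity) (ha : o.IsAnisotropic)
    (h : o.Splits X) (p : P) : o.orth (X ⊓ o.orth (point p)) = o.orth X ⊔ point p :=
  .symm <| eq_orth_of_sup_eq_top ha
    (sup_le (orth_antitone inf_le_left) (le_orth_comm.1 inf_le_right))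
    (h.inf_orth_point_sup_eq_top hpol ha p)

theorem Splits.inf_orth_point (hpol : o.IsPolarity) (ha : o.IsAnisotropic) (h : o.Splits X)
    (p : P) : o.Splits (X ⊓ o.orth (point p)) := by
  rw [Splits, h.orth_inf_orth_point hpol ha, h.inf_orth_point_sup_eq_top hpol ha]

theorem Splits.sup_point (hpol : o.IsPolarity) (ha : o.IsAnisotropic) (h : o.Splits X) (p : P) :
    o.Splits (X ⊔ point p) := by
  simpa only [(h.orth ha).orth_inf_orth_point hpol ha, h.orth_orth ha]
    using ((h.orth ha).inf_orth_point hpol ha p).orth ha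

theorem Splits.orth_inf (ha : o.IsAnisotropic) (hX : o.Splits X) (hY : o.Splits Y)
    (h : o.Splits (o.orth X ⊔ o.orth Y)) : o.orth (X ⊓ Y) = o.orth X ⊔ o.orth Y := by
  rw [← h.orth_orth ha, orth_sup, hX.orth_orth ha, hY.orth_orth ha]

theorem Splits.inf_orth_point_sup (hpol : o.IsPolarity) (ha : o.IsAnisotropic)
    (hX : o.Splits X) (hY : o.Splits Y) (h : o.Splits (o.orth X ⊔ o.orth Y)) (p : P) :
    X ⊓ o.orth (point p) ⊔ Y = X ⊔ Y ∨
      ∃ y, X ⊓ o.orth (point p) ⊔ Y = (X ⊔ Y) ⊓ o.orth (point y) := by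
  by_cases hpX : p ∈ o.orth X
  · exact .inl (by rw [inf_orth_point_of_mem_orth hpX])
  by_cases hp : p ∈ o.orth (X ⊓ Y)
  · rw [hX.orth_inf ha hY h] at hp
    obtain ⟨y, hy, -, heq⟩ := exists_inf_orth_point_eq hp hpX
    have hYy : Y ≤ o.orth (point y) := le_orth_comm.1 (point_le.2 hy)
    refine .inr ⟨y, ?_⟩
    rw [heq, sup_comm, sup_comm X, sup_inf_assoc_of_le X hYy]
  · obtain ⟨z, hz, hzp⟩ : ∃ z ∈ X ⊓ Y, ¬ o.Perp p z := by
      by_contra! h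
      exact hp fun z hz => o.symm (h z hz)
    left
    conv_rhs => rw [eq_point_sup_inf_orth_point hpol hzp hz.1]
    rw [sup_comm (point z), sup_assoc, sup_eq_right.2 (point_le.2 hz.2)]

/-! ### Finite variants of a family of splitting subspaces -/

/-- A family of splitting subspaces that contains `⊥` and is closed under joins and
orthogonal subspaces; in the anisotropic case, such a family is a modular ortholattice. -/
structure IsOrthoFamily (o : Orthogonality P) (B : Set (ProjSubspace P)) : Prop where
  splits : ∀ {X}, X ∈ B → o.Splits X
  bot_mem : ⊥ ∈ B
  sup_mem : ∀ {X Y}, X ∈ B → Y ∈ B → X ⊔ Y ∈ B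
  orth_mem : ∀ {X}, X ∈ B → o.orth X ∈ B

namespace IsOrthoFamily

variable {B : Set (ProjSubspace P)}

theorem inf_mem (hB : o.IsOrthoFamily B) (ha : o.IsAnisotropic) (hX : X ∈ B) (hY : Y ∈ B) :
    X ⊓ Y ∈ B := by
  simpa only [orth_sup, (hB.splits hX).orth_orth ha, (hB.splits hY).orth_orth ha]
    using hB.orth_mem (hB.sup_mem (hB.orth_mem hX) (hB.orth_mem hY))

theorem top_mem (hB : o.IsOrthoFamily B) : ⊤ ∈ B :=
  (hB.splits hB.bot_mem) ▸ hB.sup_mem hB.bot_mem (hB.orth_mem hB.bot_mem)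

/-- The modular ortholattice that an ortho-family forms. -/
abbrev modularOrtholattice (hB : o.IsOrthoFamily B) (ha : o.IsAnisotropic) :
    ModularOrtholattice B where
  __ := Subtype.lattice (fun _ _ => hB.sup_mem) (fun _ _ => hB.inf_mem ha)
  top := ⟨⊤, hB.top_mem⟩
  le_top X := (le_top : X.1 ≤ ⊤)
  bot := ⟨⊥, hB.bot_mem⟩
  bot_le X := (bot_le : ⊥ ≤ X.1)
  compl X := ⟨o.orth X.1, hB.orth_mem X.2⟩
  sup_compl_self X := Subtype.ext (hB.splits X.2)
  inf_compl_self X := Subtype.ext (inf_orth_self ha X.1)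
  compl_compl_self X := Subtype.ext ((hB.splits X.2).orth_orth ha)
  compl_antitone _ _ h := orth_antitone h
  sup_inf_le_assoc_of_le {X} Y {Z} h :=
    IsModularLattice.sup_inf_le_assoc_of_le (x := X.1) Y.1 (z := Z.1) h

theorem isAtomic_of_point_mem (hB : o.IsOrthoFamily B) (ha : o.IsAnisotropic)
    (hpoint : ∀ p, point p ∈ B) :
    letI := hB.modularOrtholattice ha
    IsAtomic B := by
  let _ := hB.modularOrtholattice ha
  refine ⟨fun X => or_iff_not_imp_left.2 fun hX => ?_⟩
  obtain ⟨p, hp⟩ : ∃ p, p ∈ X.1 := by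
    by_contra! h
    exact hX (Subtype.ext (le_bot_iff.1 fun p hp => h p hp))
  exact ⟨⟨point p, hpoint p⟩, ⟨fun h => (isAtom_point p).1 (congrArg Subtype.val h),
    fun Y hY => Subtype.ext ((isAtom_point p).2 Y.1 hY)⟩, point_le.2 hp⟩

end IsOrthoFamily

/-- The subspaces that arise from the members of `B` by finitely many joins with points and
meets with orthogonal subspaces of points. -/
inductive FiniteVariant (o : Orthogonality P) (B : Set (ProjSubspace P)) : ProjSubspace P → Prop
  | base {X : ProjSubspace P} (hX : X ∈ B) : FiniteVariant o B X
  | sup_point {X : ProjSubspace P} (p : P) (hX : FiniteVariant o B X) :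
      FiniteVariant o B (X ⊔ point p)
  | inf_orth_point {X : ProjSubspace P} (p : P) (hX : FiniteVariant o B X) :
      FiniteVariant o B (X ⊓ o.orth (point p))

namespace FiniteVariant

variable {B : Set (ProjSubspace P)}

theorem splits (hpol : o.IsPolarity) (ha : o.IsAnisotropic) (hB : o.IsOrthoFamily B)
    (hX : o.FiniteVariant B X) : o.Splits X := by
  induction hX with
  | base hX => exact hB.splits hX
  | sup_point p _ h => exact h.sup_point hpol ha p
  | inf_orth_point p _ h => exact h.inf_orth_point hpol ha p

theorem orth (hpol : o.IsPolarity) (ha : o.IsAnisotropic) (hB : o.IsOrthoFamily B)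
    (hX : o.FiniteVariant B X) : o.FiniteVariant B (o.orth X) := by
  induction hX with
  | base hX => exact base (hB.orth_mem hX)
  | sup_point p _ h =>
    rw [orth_sup]
    exact h.inf_orth_point p
  | inf_orth_point p hX h =>
    rw [(hX.splits hpol ha hB).orth_inf_orth_point hpol ha]
    exact h.sup_point p

theorem inf_orth_point_sup (hpol : o.IsPolarity) (ha : o.IsAnisotropic)
    (hB : o.IsOrthoFamily B) (hX : o.FiniteVariant B X) (hY : o.FiniteVariant B Y)
    (h : o.FiniteVariant B (X ⊔ Y)) (h' : o.FiniteVariant B (o.orth X ⊔ o.orth Y)) (p : P) :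
    o.FiniteVariant B (X ⊓ o.orth (point p) ⊔ Y) := by
  rcases (hX.splits hpol ha hB).inf_orth_point_sup hpol ha (hY.splits hpol ha hB)
    (h'.splits hpol ha hB) p with heq | ⟨y, heq⟩ <;> rw [heq]
  · exact h
  · exact h.inf_orth_point y

/-- The two conclusions have to be carried together: passing from `X` to `X ⊓ p^⊥` in either of
them uses the other one. -/
theorem sup_and_orth_sup_orth (hpol : o.IsPolarity) (ha : o.IsAnisotropic)
    (hB : o.IsOrthoFamily B) (hX : o.FiniteVariant B X) (hY : o.FiniteVariant B Y)
    (h : ∀ Z ∈ B, o.FiniteVariant B (Z ⊔ Y) ∧ o.FiniteVariant B (o.orth Z ⊔ o.orth Y)) :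
    o.FiniteVariant B (X ⊔ Y) ∧ o.FiniteVariant B (o.orth X ⊔ o.orth Y) := by
  induction hX with
  | base hX => exact h _ hX
  | sup_point p hX ih =>
    rw [sup_right_comm, orth_sup]
    refine ⟨ih.1.sup_point p, inf_orth_point_sup hpol ha hB (hX.orth hpol ha hB)
      (hY.orth hpol ha hB) ih.2 ?_ p⟩
    rw [(hX.splits hpol ha hB).orth_orth ha, (hY.splits hpol ha hB).orth_orth ha]
    exact ih.1
  | inf_orth_point p hX ih =>
    rw [(hX.splits hpol ha hB).orth_inf_orth_point hpol ha, sup_right_comm (o.orth _)]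
    exact ⟨inf_orth_point_sup hpol ha hB hX hY ih.1 ih.2 p, ih.2.sup_point p⟩

theorem sup (hpol : o.IsPolarity) (ha : o.IsAnisotropic) (hB : o.IsOrthoFamily B)
    (hX : o.FiniteVariant B X) (hY : o.FiniteVariant B Y) : o.FiniteVariant B (X ⊔ Y) := by
  refine (hX.sup_and_orth_sup_orth hpol ha hB hY fun Z hZ => ?_).1
  rw [sup_comm Z, sup_comm (o.orth Z)]
  exact hY.sup_and_orth_sup_orth hpol ha hB (base hZ) fun W hW =>
    ⟨base (hB.sup_mem hW hZ), base (hB.sup_mem (hB.orth_mem hW) (hB.orth_mem hZ))⟩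

theorem isOrthoFamily (hpol : o.IsPolarity) (ha : o.IsAnisotropic) (hB : o.IsOrthoFamily B) :
    o.IsOrthoFamily {X | o.FiniteVariant B X} where
  splits hX := hX.splits hpol ha hB
  bot_mem := base hB.bot_mem
  sup_mem hX hY := hX.sup hpol ha hB hY
  orth_mem hX := hX.orth hpol ha hB

theorem point_mem (h : ⊥ ∈ B) (p : P) : o.FiniteVariant B (point p) :=
  bot_sup_eq (point p) ▸ (base h).sup_point p

end FiniteVariant

theorem orth_map_of_subspacePerp {L : Type*} [ModularOrtholattice L]
    {η : BoundedLatticeHom L (ProjSubspace P)} (ha : o.IsAnisotropic) {a : L}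
    (hη : o.SubspacePerp (η a) (η aᶜ)) : η aᶜ = o.orth (η a) :=
  eq_orth_of_sup_eq_top ha (fun q hq p hp => hη p hp q hq)
    (by rw [← map_sup, Ortholattice.sup_compl_self, map_top])

theorem isOrthoFamily_range {L : Type*} [ModularOrtholattice L]
    {η : BoundedLatticeHom L (ProjSubspace P)} (hη : ∀ a, η aᶜ = o.orth (η a)) :
    o.IsOrthoFamily (Set.range η) where
  splits := by
    rintro _ ⟨a, rfl⟩
    rw [Splits, ← hη, ← map_sup, Ortholattice.sup_compl_self, map_top]
  bot_mem := ⟨⊥, map_bot η⟩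
  sup_mem := by
    rintro _ _ ⟨a, rfl⟩ ⟨b, rfl⟩
    exact ⟨a ⊔ b, map_sup η a b⟩
  orth_mem := by
    rintro _ ⟨a, rfl⟩
    exact ⟨aᶜ, hη a⟩

end Orthogonality

theorem HasGeometricRepresentation.hasAtomicExtension {L : Type u} [ModularOrtholattice L]
    (h : HasGeometricRepresentation L) : HasAtomicExtension L := by
  obtain ⟨P, _, o, η, hpol, ha, hinj, hη⟩ := h
  have horth (a : L) : η aᶜ = o.orth (η a) := Orthogonality.orth_map_of_subspacePerp ha (hη a)
  have hB := Orthogonality.isOrthoFamily_range horth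
  have hV := Orthogonality.FiniteVariant.isOrthoFamily hpol ha hB
  let _ := hV.modularOrtholattice ha
  let f : BoundedLatticeHom L {X | o.FiniteVariant (Set.range η) X} :=
    { toFun a := ⟨η a, .base ⟨a, rfl⟩⟩
      map_sup' a b := Subtype.ext (map_sup η a b)
      map_inf' a b := Subtype.ext (map_inf η a b)
      map_top' := Subtype.ext (map_top η)
      map_bot' := Subtype.ext (map_bot η) }
  exact ⟨_, _, f,
    hV.isAtomic_of_point_mem ha (Orthogonality.FiniteVariant.point_mem hB.bot_mem),
    fun a b hab => hinj (congrArg Subtype.val hab), fun a => Subtype.ext (horth a)⟩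

end MOL

theorem theorem1p1 (L : Type u) [MOL.ModularOrtholattice L] :
    List.TFAE [MOL.IsProatomic L, MOL.HasAtomicExtension L,
      MOL.HasGeometricRepresentation L] := by
  tfae_have 1 → 3 := MOL.IsProatomic.hasGeometricRepresentation
  tfae_have 3 → 2 := MOL.HasGeometricRepresentation.hasAtomicExtension
  tfae_have 2 → 1 := MOL.HasAtomicExtension.isProatomic
  tfae_finish
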